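/- Let $G$ be a finite simple graph with vertex set $V(G)$, and let $\pi=\{W_1,\dots,W_r\}$ be a clique partition of $G$: the $W_i$ are pairwise disjoint (possibly empty) cliques of $G$ whose union is $V(G)$. Let $n_1,\dots,n_r$ be positive integers. The multi-clique-whiskered graph $G^{\pi}[n_1,\dots,n_r]$ is the graph on the vertex set $V(G)\cup\{w_{i,k} : 1\le i\le r,\ 1\le k\le n_i\}$, where the $w_{i,k}$ are distinct new vertices, with edge set $$E(G)\cup\bigcup_{1\le i\le r}\{\{x,w_{i,k}\} : x\in W_i,\ 1\le k\le n_i\}.$$ A simplicial complex $\Delta$ is called vertex decomposable if either $\Delta$ is void or a simplex (including $\{\emptyset\}$), or there is a vertex $x$ of $\Delta$ such that $\mathrm{link}_\Delta(x)=\{F\in\Delta : x\notin F,\ F\cup\{x\}\in\Delta\}$ and $\mathrm{del}_\Delta(x)=\{F\in\Delta : x\notin F\}$ are vertex decomposable and every facet of $\mathrm{del}_\Delta(x)$ is a facet of $\Delta$. A finitely generated graded module $M$ over a polynomial ring $S=\Bbbk[x_1,\dots,x_m]$ is called sequentially Cohen--Macaulay if there is a filtration $0=M_0\subsetneq M_1\subsetneq\cdots\subsetneq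 M_t=M$ by graded submodules such that every $M_i/M_{i-1}$ is Cohen--Macaulay and $\dim M_i/M_{i-1}<\dim M_{i+1}/M_i$ for all $1\le i<t$. Theorem. The graph $H=G^{\pi}[n_1,\dots,n_r]$ is vertex decomposable, i.e. the complex of independent sets of $H$ is vertex decomposable; and hence $H$ is sequentially Cohen--Macaulay over every field $\Bbbk$, i.e. $S/I(H)$ is a sequentially Cohen--Macaulay graded $S$-module, where $S=\Bbbk[x_v : v\in V(H)]$ and $I(H)=(x_ux_v : \{u,v\}\in E(H))$. -/

import Mathlib

open MvPolynomial

/-! ### Simplicial complexes and vertex decomposability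

A simplicial complex with vertices in `α` is a family of finite sets (its faces) closed under
passing to subsets, that is, a lower set of `Finset α`. The empty set is a face of every complex
except the void one, `⊥`. -/

namespace SimplicialFamily

variable {α : Type*} [DecidableEq α]

/-- The link of the vertex `x`: all faces `F` with `x ∉ F` and `{x} ∪ F ∈ Δ`. -/
def link (Δ : LowerSet (Finset α)) (x : α) : LowerSet (Finset α) where
  carrier := {F | F ∈ Δ ∧ x ∉ F ∧ insert x F ∈ Δ}
  lower' _ _ hle h :=
    ⟨Δ.lower hle h.1, fun hx => h.2.1 (hle hx), Δ.lower (Finset.insert_subset_insert x hle) h.2.2⟩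

/-- The deletion of the vertex `x`: all faces `F` with `x ∉ F`. -/
def deletion (Δ : LowerSet (Finset α)) (x : α) : LowerSet (Finset α) where
  carrier := {F | F ∈ Δ ∧ x ∉ F}
  lower' _ _ hle h := ⟨Δ.lower hle h.1, fun hx => h.2 (hle hx)⟩

/-- `F` is a facet of `Δ`: a face that is maximal with respect to inclusion. -/
def IsFacet (Δ : LowerSet (Finset α)) (F : Finset α) : Prop :=
  Maximal (fun A => A ∈ Δ) F

/-- (Nonpure) vertex decomposability. The base cases are the void complex and the simplex
`⟨F⟩` of all subsets of a finite set `F` (for `F = ∅` this is the complex `{∅}`). Otherwise there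
is a vertex `x` of `Δ` with vertex decomposable link and deletion such that
every facet of the deletion is a facet of `Δ`. -/
inductive VertexDecomposable : LowerSet (Finset α) → Prop
  | void : VertexDecomposable ⊥
  | simplex (F : Finset α) : VertexDecomposable (LowerSet.Iic F)
  | shed (Δ : LowerSet (Finset α)) (x : α) (hx : {x} ∈ Δ)
      (hlink : VertexDecomposable (link Δ x))
      (hdel : VertexDecomposable (deletion Δ x))
      (hfacet : ∀ F, IsFacet (deletion Δ x) F → IsFacet Δ F) : VertexDecomposable Δ

end SimplicialFamily

/-! ### Cohen–Macaulay and sequentially Cohen–Macaulay graded modules -/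

namespace GradedCM

/-- The homogeneous maximal ideal `(x_v : v ∈ σ)` of the polynomial ring. -/
noncomputable def irrelevantIdeal (σ k : Type*) [Field k] : Ideal (MvPolynomial σ k) :=
  Ideal.span (Set.range X)

/-- The depth of `M`: the supremum of the lengths of the `M`-regular sequences with entries in
the homogeneous maximal ideal. -/
noncomputable def depth (σ k : Type*) [Field k]
    (M : Type*) [AddCommGroup M] [Module (MvPolynomial σ k) M] : ℕ∞ :=
  ⨆ rs : {rs : List (MvPolynomial σ k) //
    (∀ f ∈ rs, f ∈ irrelevantIdeal σ k) ∧ RingTheory.Sequence.IsRegular M rs}, (rs.1.length : ℕ∞)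

/-- A (finitely generated graded) module over the polynomial ring is Cohen–Macaulay if it is zero
or its depth equals its Krull dimension. -/
def IsCohenMacaulay (σ k : Type*) [Field k]
    (M : Type*) [AddCommGroup M] [Module (MvPolynomial σ k) M] : Prop :=
  Subsingleton M ∨
    (depth σ k M : WithBot ℕ∞) = Module.supportDim (MvPolynomial σ k) M

/-- A graded module `M` over the (standard graded) polynomial ring `S`, with grading `ℳ`, is
sequentially Cohen–Macaulay if there is a filtration `0 = N 0 ⊂ N 1 ⊂ ⋯ ⊂ N t = M` by graded
submodules with all `N (i + 1) / N i` Cohen–Macaulay and of strictly increasing dimension. -/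
def IsSequentiallyCohenMacaulay {σ k : Type*} [Field k]
    {M : Type*} [AddCommGroup M] [Module (MvPolynomial σ k) M] [Module k M]
    [IsScalarTower k (MvPolynomial σ k) M]
    {ι : Type*} [DecidableEq ι] [VAdd ℕ ι]
    (ℳ : ι → Submodule k M) [DirectSum.Decomposition ℳ]
    [SetLike.GradedSMul (homogeneousSubmodule σ k) ℳ] : Prop :=
  ∃ (t : ℕ) (N : ℕ → Submodule (MvPolynomial σ k) M),
    N 0 = ⊥ ∧ N t = ⊤ ∧
    (∀ i ≤ t, (N i).IsHomogeneous ℳ) ∧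
    (∀ i < t, N i < N (i + 1)) ∧
    (∀ i < t, IsCohenMacaulay σ k (N (i + 1) ⧸ (N i).submoduleOf (N (i + 1)))) ∧
    (∀ i, i + 1 < t →
      Module.supportDim (MvPolynomial σ k) (N (i + 1) ⧸ (N i).submoduleOf (N (i + 1))) <
        Module.supportDim (MvPolynomial σ k)
          (N (i + 2) ⧸ (N (i + 1)).submoduleOf (N (i + 2))))

/-- The grading of `S / I` induced by the standard grading of the polynomial ring `S`: its degree
`d` part consists of the residue classes of homogeneous polynomials of degree `d`. -/
noncomputable def quotientGrading {σ k : Type*} [Field k] (I : Ideal (MvPolynomial σ k)) (d : ℕ) :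
    Submodule k (MvPolynomial σ k ⧸ I) :=
  (homogeneousSubmodule σ k d).map (Ideal.Quotient.mkₐ k I).toLinearMap

instance quotientGrading_gradedSMul {σ k : Type*} [Field k] (I : Ideal (MvPolynomial σ k)) :
    SetLike.GradedSMul (homogeneousSubmodule σ k) (quotientGrading I) where
  smul_mem := by
    rintro i j a m ha ⟨b, hb, rfl⟩
    exact ⟨a * b, IsHomogeneous.mul ha hb, by
      simp only [AlgHom.toLinearMap_apply, map_mul]; rfl⟩

attribute [local instance] MvPolynomial.gradedAlgebra

/-- The projection `S_d → (S / I)_d`. -/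
noncomputable def quotientComponent {σ k : Type*} [Field k] (I : Ideal (MvPolynomial σ k))
    (d : ℕ) : homogeneousSubmodule σ k d →+ quotientGrading I d where
  toFun a := ⟨Ideal.Quotient.mk I a, a, a.2, rfl⟩
  map_zero' := by ext; simp
  map_add' a b := by ext; simp

/-- For a homogeneous ideal `I`, the module `S / I` is the direct sum of its graded parts. -/
@[reducible] noncomputable def quotientDecomposition {σ k : Type*} [Field k]
    (I : Ideal (MvPolynomial σ k)) (hI : I.IsHomogeneous (homogeneousSubmodule σ k)) :
    DirectSum.Decomposition (quotientGrading I) :=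
  DirectSum.Decomposition.ofAddHom (quotientGrading I)
    (QuotientAddGroup.lift I.toAddSubgroup
      ((DirectSum.map (quotientComponent I)).comp
        (DirectSum.decomposeAddEquiv (homogeneousSubmodule σ k)).toAddMonoidHom)
      (by
        intro x hx
        refine DFinsupp.ext fun d => ?_
        have h := hI d hx
        apply Subtype.ext
        simpa [quotientComponent, DirectSum.map_apply] using Ideal.Quotient.eq_zero_iff_mem.2 h))
    (by
      ext x
      obtain ⟨x, rfl⟩ := Ideal.Quotient.mk_surjective x
      change DirectSum.coeAddMonoidHom (quotientGrading I)
        (DirectSum.map (quotientComponent I)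
          (DirectSum.decompose (homogeneousSubmodule σ k) x)) = Ideal.Quotient.mk I x
      induction x using DirectSum.Decomposition.inductionOn (homogeneousSubmodule σ k) with
      | zero => simp
      | homogeneous m => simp [DirectSum.map_of, quotientComponent]
      | add a b ha hb => simp only [DirectSum.decompose_add, map_add, ha, hb])
    (by
      ext d ⟨_, a, ha, rfl⟩ : 2
      refine (congrArg _ (DirectSum.coeAddMonoidHom_of (quotientGrading I) d
        (⟨_, a, ha, rfl⟩ : quotientGrading I d))).trans ?_
      change DirectSum.map (quotientComponent I)
          (DirectSum.decompose (homogeneousSubmodule σ k) a) = _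
      lift a to homogeneousSubmodule σ k d using ha
      rw [DirectSum.decompose_coe, DirectSum.map_of]
      rfl)

end GradedCM

/-! ### Graphs -/

namespace SimpleGraph

/-- The independence complex of `G`: the finite independent sets of vertices. -/
def independenceComplex {V : Type*} (G : SimpleGraph V) : LowerSet (Finset V) where
  carrier := {F | G.IsIndepSet (F : Set V)}
  lower' _ _ hle h := Set.Pairwise.mono (Finset.coe_subset.2 hle) h

/-- A graph is vertex decomposable if its independence complex is. -/
def IsVertexDecomposable {V : Type*} [DecidableEq V] (G : SimpleGraph V) : Prop :=
  SimplicialFamily.VertexDecomposable G.independenceComplex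

/-- The edge ideal `I(G) = (x_u x_v : {u, v} ∈ E(G))`. -/
noncomputable def edgeIdeal {V : Type*} (k : Type*) [Field k] (G : SimpleGraph V) :
    Ideal (MvPolynomial V k) :=
  Ideal.span {f | ∃ u v, G.Adj u v ∧ f = X u * X v}

attribute [local instance] MvPolynomial.gradedAlgebra in
theorem edgeIdeal_isHomogeneous {V : Type*} (k : Type*) [Field k] (G : SimpleGraph V) :
    (G.edgeIdeal k).IsHomogeneous (homogeneousSubmodule V k) := by
  refine Ideal.homogeneous_span _ _ ?_
  rintro _ ⟨u, v, -, rfl⟩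
  exact ⟨2, (isHomogeneous_X k u).mul (isHomogeneous_X k v)⟩

noncomputable instance edgeIdeal_decomposition {V : Type*} (k : Type*) [Field k]
    (G : SimpleGraph V) : DirectSum.Decomposition (GradedCM.quotientGrading (G.edgeIdeal k)) :=
  GradedCM.quotientDecomposition _ (G.edgeIdeal_isHomogeneous k)

/-- `G` is sequentially Cohen–Macaulay over `k` if the graded `S`-module `S / I(G)` is, where
`S = k[V(G)]`. -/
def IsSequentiallyCohenMacaulay {V : Type*} (k : Type*) [Field k] (G : SimpleGraph V) : Prop :=
  GradedCM.IsSequentiallyCohenMacaulay (σ := V) (GradedCM.quotientGrading (G.edgeIdeal k))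

/-- `W 0, …, W (r - 1)` is a clique partition of `G`: each `W i` is a clique, and `V(G)` is the
disjoint union of the `W i`. -/
structure IsCliquePartition {V : Type*} (G : SimpleGraph V) {r : ℕ} (W : Fin r → Set V) :
    Prop where
  isClique : ∀ i, G.IsClique (W i)
  disjoint : Pairwise fun i j => Disjoint (W i) (W j)
  iUnion_eq : ⋃ i, W i = Set.univ

/-- The multi-clique-whiskered graph: for every `i` there are `n i` new vertices
`w_{i,k} = Sum.inr ⟨i, k⟩`, each joined to exactly the vertices of `W i`. -/
def multiCliqueWhisker {V : Type*} (G : SimpleGraph V) {r : ℕ} (W : Fin r → Set V)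
    (n : Fin r → ℕ) : SimpleGraph (V ⊕ (Σ i : Fin r, Fin (n i))) where
  Adj
    | Sum.inl u, Sum.inl v => G.Adj u v
    | Sum.inl u, Sum.inr w => u ∈ W w.1
    | Sum.inr w, Sum.inl u => u ∈ W w.1
    | Sum.inr _, Sum.inr _ => False
  symm := ⟨by
    rintro (u | w) (v | w') h
    · exact G.adj_symm h
    · exact h
    · exact h
    · exact h⟩
  loopless := ⟨by
    rintro (u | w) h
    · exact G.irrefl h
    · exact h⟩

end SimpleGraph

/-! Vertex decomposability. Every vertex `u` of `G` has a whisker `z` whose neighbours form a clique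
containing `u`. Any vertex of `G` can then be shed, and the whisker condition survives in both link
and deletion. The induction ends when only an independent set remains, whose complex is a simplex
(`vertexDecomposable_independenceComplexOn`).

The sequential Cohen–Macaulay property is proved directly, by an explicit filtration. Each facet of
the independence complex is determined by its trace `A` on `V(G)`, an independent set of `G`: the
facet `F_A` consists of `A` and all whiskers at cliques missed by `A`. When the monomials `x_A` are
adjoined to the edge ideal, larger `A` first, each step has colon ideal `(x_v : v ∉ F_A)`
(`mul_prod_mem_whiskerIdeal_iff`), so it contributes a polynomial ring on `F_A`. Enlarging `A`
cannot enlarge `F_A` (`card_whiskerFacet_le`), so the monomials may also be adjoined in order of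
increasing `|F_A|`. Grouping them by size gives the filtration, with dimensions `|F_A|`.

A layer of dimension `d` is an iterated extension of rings `S/P_F` with `|F| = d`. It is
Cohen–Macaulay because the elementary symmetric polynomials `e_d, …, e_1` are weakly regular on all
these rings at once (`isWeaklyRegular_esymmSeq`), and weak regularity passes to extensions. -/

namespace SimpleGraph

open SimplicialFamily

/-! ### Shedding vertices that have a simplicial whisker -/

section VertexDecomposable

variable {α : Type*}

/-- The complex of the independent sets of `H` that are contained in `T`. -/
def independenceComplexOn (H : SimpleGraph α) (T : Finset α) : LowerSet (Finset α) where
  carrier := {F | F ⊆ T ∧ H.IsIndepSet (F : Set α)}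
  lower' _ _ hle h := ⟨hle.trans h.1, Set.Pairwise.mono (Finset.coe_subset.2 hle) h.2⟩

theorem mem_independenceComplexOn {H : SimpleGraph α} {T F : Finset α} :
    F ∈ H.independenceComplexOn T ↔ F ⊆ T ∧ H.IsIndepSet (F : Set α) := Iff.rfl

variable [DecidableEq α]

theorem isIndepSet_insert_iff {H : SimpleGraph α} {F : Finset α} {x : α} :
    H.IsIndepSet ((insert x F : Finset α) : Set α) ↔
      H.IsIndepSet (F : Set α) ∧ ∀ v ∈ F, ¬ H.Adj x v := by
  rw [Finset.coe_insert, IsIndepSet, Set.pairwise_insert]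
  refine and_congr_right fun _ => ⟨fun h v hv hxv => (h v hv hxv.ne).1 hxv, fun h v hv _ =>
    ⟨h v hv, fun hvx => h v hv hvx.symm⟩⟩

theorem deletion_independenceComplexOn (H : SimpleGraph α) (T : Finset α) (x : α) :
    deletion (H.independenceComplexOn T) x = H.independenceComplexOn (T.erase x) := by
  ext F
  change (F ⊆ T ∧ H.IsIndepSet (F : Set α)) ∧ x ∉ F ↔ F ⊆ T.erase x ∧ H.IsIndepSet (F : Set α)
  rw [Finset.subset_erase]
  tauto

open Classical in
theorem link_independenceComplexOn (H : SimpleGraph α) {T : Finset α} {x : α} (hx : x ∈ T) :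
    link (H.independenceComplexOn T) x =
      H.independenceComplexOn {v ∈ T | v ≠ x ∧ ¬ H.Adj x v} := by
  ext F
  change (F ∈ H.independenceComplexOn T ∧ x ∉ F ∧ insert x F ∈ H.independenceComplexOn T) ↔ _
  simp only [mem_independenceComplexOn, isIndepSet_insert_iff, Finset.insert_subset_iff]
  constructor
  · rintro ⟨⟨hT, hi⟩, hxF, -, -, hadj⟩
    refine ⟨fun v hv => Finset.mem_filter.2 ⟨hT hv, ?_, hadj v hv⟩, hi⟩
    rintro rfl
    exact hxF hv
  · rintro ⟨hT, hi⟩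
    have hT' : F ⊆ T := hT.trans (Finset.filter_subset _ _)
    exact ⟨⟨hT', hi⟩, fun h => (Finset.mem_filter.1 (hT h)).2.1 rfl, ⟨hx, hT'⟩, hi,
      fun v hv => (Finset.mem_filter.1 (hT hv)).2.2⟩

/-- If `Z` is independent and every vertex of `U` has a neighbour in `Z` whose neighbours in `U`
form a clique, then the graph induced on `U ∪ Z` is vertex decomposable. -/
theorem vertexDecomposable_independenceComplexOn (H : SimpleGraph α) (U Z : Finset α)
    (hUZ : Disjoint U Z) (hZ : H.IsIndepSet (Z : Set α))
    (hU : ∀ u ∈ U, ∃ z ∈ Z, H.Adj z u ∧ H.IsClique {v | v ∈ U ∧ H.Adj z v}) :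
    VertexDecomposable (H.independenceComplexOn (U ∪ Z)) := by
  classical
  induction hn : U.card using Nat.strong_induction_on generalizing U Z with
  | _ m ih =>
  subst hn
  rcases U.eq_empty_or_nonempty with rfl | ⟨x, hx⟩
  · have h : H.independenceComplexOn (∅ ∪ Z) = LowerSet.Iic Z := by
      ext F
      change (F ⊆ ∅ ∪ Z ∧ H.IsIndepSet (F : Set α)) ↔ F ⊆ Z
      rw [Finset.empty_union, and_iff_left_iff_imp]
      exact fun h => Set.Pairwise.mono (Finset.coe_subset.2 h) hZ
    rw [h]
    exact .simplex Z
  · have hxZ : x ∉ Z := Finset.disjoint_left.1 hUZ hx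
    have hxT : x ∈ U ∪ Z := Finset.mem_union_left _ hx
    have hdel : (U ∪ Z).erase x = U.erase x ∪ Z := by
      rw [Finset.erase_union_distrib, Finset.erase_eq_of_notMem hxZ]
    refine .shed _ x ⟨by simpa using hxT, by simp [IsIndepSet]⟩ ?_ ?_ ?_
    · rw [link_independenceComplexOn H hxT, Finset.filter_union]
      refine ih _ (Finset.card_lt_card (Finset.filter_ssubset.2 ⟨x, hx, by simp⟩)) _ _
        (Finset.disjoint_filter_filter hUZ)
        (Set.Pairwise.mono (Finset.coe_subset.2 (Finset.filter_subset _ _)) hZ) ?_ rfl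
      intro u hu
      obtain ⟨huU, hux, hxu⟩ := Finset.mem_filter.1 hu
      obtain ⟨z, hz, hzu, hcl⟩ := hU u huU
      refine ⟨z, Finset.mem_filter.2 ⟨hz, fun h => hxZ (h ▸ hz), fun hxz => ?_⟩, hzu,
        Set.Pairwise.mono (by intro v hv; exact ⟨(Finset.mem_filter.1 hv.1).1, hv.2⟩) hcl⟩
      -- If `x` were adjacent to `z`, then `x` and `u` would lie in one clique of neighbours of `z`,
      -- so `u` could not belong to the link of `x`.
      exact hxu (hcl ⟨hx, hxz.symm⟩ ⟨huU, hzu⟩ hux.symm)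
    · rw [deletion_independenceComplexOn, hdel]
      refine ih _ (Finset.card_erase_lt_of_mem hx) _ _
        (hUZ.mono_left (Finset.erase_subset _ _)) hZ ?_ rfl
      intro u hu
      obtain ⟨z, hz, hzu, hcl⟩ := hU u (Finset.mem_of_mem_erase hu)
      exact ⟨z, hz, hzu,
        Set.Pairwise.mono (by intro v hv; exact ⟨Finset.mem_of_mem_erase hv.1, hv.2⟩) hcl⟩
    · rw [deletion_independenceComplexOn, hdel]
      rintro F ⟨⟨hFT, hFi⟩, hmax⟩
      refine ⟨⟨hFT.trans (Finset.union_subset_union_left (Finset.erase_subset _ _)), hFi⟩, ?_⟩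
      intro K hK hFK
      by_cases hxK : x ∈ K
      -- A face `K ⊇ F` containing `x` contains neither `z` nor any other neighbour of `z` in `U`,
      -- as these are all adjacent to `x`. So `z` can be added to `F` within the deletion,
      -- contradicting maximality.
      · obtain ⟨z, hz, hzx, hcl⟩ := hU x hx
        have hzF : z ∉ F := fun h => hK.2 (hFK h) hxK hzx.ne hzx
        have hins : insert z F ∈ H.independenceComplexOn (U.erase x ∪ Z) := by
          refine ⟨Finset.insert_subset (Finset.mem_union_right _ hz) hFT,
            isIndepSet_insert_iff.2 ⟨hFi, fun v hv hzv => ?_⟩⟩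
          rcases Finset.mem_union.1 (hFT hv) with hvU | hvZ
          · obtain ⟨hvx, hvU⟩ := Finset.mem_erase.1 hvU
            exact hK.2 (hFK hv) hxK hvx (hcl ⟨hvU, hzv⟩ ⟨hx, hzx⟩ hvx)
          · exact hZ hz hvZ hzv.ne hzv
        exact absurd (hmax hins (Finset.subset_insert _ _) (Finset.mem_insert_self _ _)) hzF
      · refine hmax ⟨?_, hK.2⟩ hFK
        rw [← hdel]
        exact Finset.subset_erase.2 ⟨hK.1, hxK⟩

end VertexDecomposable

theorem isVertexDecomposable_multiCliqueWhisker {V : Type*} [Fintype V] [DecidableEq V]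
    {G : SimpleGraph V} {r : ℕ} {W : Fin r → Set V} (hW : G.IsCliquePartition W)
    {n : Fin r → ℕ} (hn : ∀ i, 0 < n i) :
    (G.multiCliqueWhisker W n).IsVertexDecomposable := by
  have h := vertexDecomposable_independenceComplexOn (G.multiCliqueWhisker W n)
    (Finset.univ.map .inl) (Finset.univ.map .inr)
    (by simp [Finset.disjoint_left])
    (by
      intro a ha b hb _
      simp only [Finset.coe_map, Set.mem_image, Function.Embedding.inr_apply] at ha hb
      obtain ⟨a, -, rfl⟩ := ha
      obtain ⟨b, -, rfl⟩ := hb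
      exact id)
    (by
      intro u hu
      simp only [Finset.mem_map, Finset.mem_univ, true_and, Function.Embedding.inl_apply] at hu
      obtain ⟨u, rfl⟩ := hu
      obtain ⟨i, hi⟩ := Set.mem_iUnion.1 (hW.iUnion_eq ▸ Set.mem_univ u : u ∈ ⋃ i, W i)
      -- The first whisker at the clique of `u` serves; it exists because `n i` is positive.
      refine ⟨Sum.inr ⟨i, 0, hn i⟩, by simp, hi, ?_⟩
      rintro (a | a) ⟨ha, haz⟩ (b | b) ⟨hb, hbz⟩ hab
      · exact hW.isClique i haz hbz fun h => hab (h ▸ rfl)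
      all_goals simp at ha hb)
  rw [IsVertexDecomposable]
  convert h using 1
  ext F
  refine (and_iff_right ?_).symm
  rintro (v | v) - <;> simp

end SimpleGraph

/-! ### Weakly regular sequences, extensions and subquotients -/

section RegularSequences

open RingTheory.Sequence Submodule
open scoped Pointwise

variable {R : Type*} [CommRing R]

/-- If `f x = r • y`, then `r` kills `g y`, so `g y = 0` by regularity; hence `y` comes from `M` and
`x` is already a multiple of `r` there. -/
theorem QuotSMulTop.map_injective_of_isSMulRegular {M M' M'' : Type*} [AddCommGroup M] [Module R M]
    [AddCommGroup M'] [Module R M'] [AddCommGroup M''] [Module R M''] {f : M →ₗ[R] M'}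
    {g : M' →ₗ[R] M''} (hf : Function.Injective f) (hfg : Function.Exact f g) {r : R}
    (hr : IsSMulRegular M'' r) : Function.Injective (QuotSMulTop.map r f) := by
  rw [injective_iff_map_eq_zero]
  intro x hx
  obtain ⟨x, rfl⟩ := Submodule.Quotient.mk_surjective _ x
  rw [QuotSMulTop.map_apply_mk, Submodule.Quotient.mk_eq_zero] at hx
  obtain ⟨y, -, hy⟩ := hx
  change r • y = f x at hy
  have hgy : g y = 0 := hr.right_eq_zero_of_smul <| by
    rw [← map_smul, hy, hfg.apply_apply_eq_zero]
  obtain ⟨z, rfl⟩ := (hfg y).1 hgy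
  rw [← map_smul] at hy
  rw [Submodule.Quotient.mk_eq_zero, ← hf hy]
  exact Submodule.smul_mem_pointwise_smul _ _ _ mem_top

/-- Weakly regular sequences are inherited by extensions. -/
theorem RingTheory.Sequence.IsWeaklyRegular.of_exact {M M' M'' : Type*} [AddCommGroup M]
    [Module R M] [AddCommGroup M'] [Module R M'] [AddCommGroup M''] [Module R M'']
    {f : M →ₗ[R] M'} {g : M' →ₗ[R] M''} (hf : Function.Injective f) (hg : Function.Surjective g)
    (hfg : Function.Exact f g) {rs : List R} (h : IsWeaklyRegular M rs)
    (h'' : IsWeaklyRegular M'' rs) : IsWeaklyRegular M' rs := by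
  induction rs generalizing M M' M'' with
  | nil => exact .nil R M'
  | cons r rs ih =>
    rw [isWeaklyRegular_cons_iff] at h h'' ⊢
    exact ⟨isSMulRegular_of_range_eq_ker hf hfg.linearMap_ker_eq.symm h.1 h''.1,
      ih (QuotSMulTop.map_injective_of_isSMulRegular hf hfg h''.1)
        (QuotSMulTop.map_surjective r hg) (QuotSMulTop.map_exact r hfg hg) h.2 h''.2⟩

theorem RingTheory.Sequence.IsWeaklyRegular.of_subsingleton {M : Type*} [AddCommGroup M]
    [Module R M] [Subsingleton M] (rs : List R) : IsWeaklyRegular M rs := by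
  induction rs generalizing M with
  | nil => exact .nil R M
  | cons r rs ih =>
    exact .cons (fun _ _ _ => Subsingleton.elim _ _) ih

/-- If `b` is regular on `M`, there is an exact sequence `0 → M/aM → M/baM → M/bM → 0`. -/
theorem RingTheory.Sequence.IsWeaklyRegular.quotSMulTop_mul {M : Type*} [AddCommGroup M]
    [Module R M] {a b : R} (hb : IsSMulRegular M b) {rs : List R}
    (h₁ : IsWeaklyRegular (QuotSMulTop a M) rs) (h₂ : IsWeaklyRegular (QuotSMulTop b M) rs) :
    IsWeaklyRegular (QuotSMulTop (b * a) M) rs := by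
  have hle : a • (⊤ : Submodule R M) ≤ ((b * a) • (⊤ : Submodule R M)).comap
      (LinearMap.lsmul R M b) := by
    rintro _ ⟨x, -, rfl⟩
    exact ⟨x, trivial, mul_smul b a x⟩
  have hle' : (b * a) • (⊤ : Submodule R M) ≤ (b • (⊤ : Submodule R M)).comap LinearMap.id := by
    rintro _ ⟨x, -, rfl⟩
    exact ⟨a • x, trivial, (mul_smul b a x).symm⟩
  refine IsWeaklyRegular.of_exact (f := mapQ _ _ _ hle) (g := mapQ _ _ _ hle') ?_ ?_ ?_ h₁ h₂
  · rw [injective_iff_map_eq_zero]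
    intro x hx
    obtain ⟨x, rfl⟩ := Submodule.Quotient.mk_surjective _ x
    rw [mapQ_apply, Submodule.Quotient.mk_eq_zero] at hx
    obtain ⟨y, -, hy⟩ := hx
    rw [Submodule.Quotient.mk_eq_zero]
    exact ⟨y, trivial, hb ((mul_smul b a y).symm.trans hy)⟩
  · intro x
    obtain ⟨x, rfl⟩ := Submodule.Quotient.mk_surjective _ x
    exact ⟨Submodule.Quotient.mk x, rfl⟩
  · intro x
    obtain ⟨x, rfl⟩ := Submodule.Quotient.mk_surjective _ x
    rw [mapQ_apply, Submodule.Quotient.mk_eq_zero]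
    constructor
    · rintro ⟨y, -, hy⟩
      exact ⟨Submodule.Quotient.mk y, congrArg _ hy⟩
    · rintro ⟨y, hy⟩
      obtain ⟨y, rfl⟩ := Submodule.Quotient.mk_surjective _ y
      rw [mapQ_apply, Submodule.Quotient.eq] at hy
      have hx : b • y - (b • y - x) ∈ b • (⊤ : Submodule R M) :=
        sub_mem ⟨y, trivial, rfl⟩ (hle' hy)
      rwa [sub_sub_cancel] at hx

/-- Peeling off one factor at a time exhibits the quotient by the product as an iterated extension
of the quotients by the factors. -/
theorem RingTheory.Sequence.IsWeaklyRegular.quotSMulTop_prod {M : Type*} [AddCommGroup M]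
    [Module R M] {ι : Type*} (s : Finset ι) (b : ι → R) {rs : List R}
    (hb : ∀ i ∈ s, IsSMulRegular M (b i))
    (h : ∀ i ∈ s, IsWeaklyRegular (QuotSMulTop (b i) M) rs) :
    IsWeaklyRegular (QuotSMulTop (∏ i ∈ s, b i) M) rs := by
  classical
  induction s using Finset.induction_on with
  | empty =>
    rw [Finset.prod_empty]
    have : Subsingleton (QuotSMulTop (1 : R) M) := by
      rw [Submodule.Quotient.subsingleton_iff, one_smul]
    exact .of_subsingleton rs
  | insert i s hi ih =>
    rw [Finset.prod_insert hi]
    exact .quotSMulTop_mul (hb i (Finset.mem_insert_self _ _))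
      (ih (fun j hj => hb j (Finset.mem_insert_of_mem hj))
        fun j hj => h j (Finset.mem_insert_of_mem hj)) (h i (Finset.mem_insert_self _ _))

/-- A regular element avoids the minimal primes of the annihilator, so dividing by it lowers the
dimension by at least one. -/
theorem Module.length_le_supportDim_of_isRegular {M : Type*} [AddCommGroup M]
    [Module R M] [Module.Finite R M] {rs : List R} (h : IsRegular M rs) :
    (rs.length : WithBot ℕ∞) ≤ supportDim R M := by
  induction rs generalizing M with
  | nil =>
    have := h.nontrivial
    obtain ⟨p, hp⟩ := nonempty_support_of_nontrivial (R := R) (M := M)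
    have : Nonempty (Module.support R M) := ⟨p, hp⟩
    simpa using! Order.krullDim_nonneg
  | cons r rs ih =>
    rw [isRegular_cons_iff] at h
    refine le_trans ?_ (supportDim_quotSMulTop_succ_le_of_notMem_minimalPrimes
      fun _ => h.1.notMem_of_mem_minimalPrimes)
    rw [List.length_cons, Nat.cast_succ]
    gcongr
    exact ih h.2

/-- If `L' = L + (a)` and `P = L : a`, then `L'/L ≅ R/P`. -/
noncomputable def Submodule.quotientEquivOfSupSpan {M : Type*} [AddCommGroup M] [Module R M]
    {L L' : Submodule R M} {a : M} {P : Ideal R} (hL' : L' = L ⊔ span R {a})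
    (hP : ∀ r : R, r • a ∈ L ↔ r ∈ P) :
    (R ⧸ P) ≃ₗ[R] (L' ⧸ L.submoduleOf L') :=
  have ha : a ∈ L' := hL' ▸ mem_sup_right (mem_span_singleton_self a)
  let φ : R →ₗ[R] (L' ⧸ L.submoduleOf L') :=
    (L.submoduleOf L').mkQ ∘ₗ LinearMap.toSpanSingleton R L' ⟨a, ha⟩
  have hker : P = LinearMap.ker φ := by
    ext r
    rw [LinearMap.mem_ker, ← hP r]
    exact (Submodule.Quotient.mk_eq_zero (L.submoduleOf L') (x := r • ⟨a, ha⟩)).symm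
  have hsurj : Function.Surjective φ := by
    intro x
    obtain ⟨⟨x, hx⟩, rfl⟩ := Submodule.Quotient.mk_surjective _ x
    have hx' := hx
    rw [hL'] at hx'
    obtain ⟨y, hy, z, hz, hyz⟩ := mem_sup.1 hx'
    obtain ⟨r, rfl⟩ := mem_span_singleton.1 hz
    refine ⟨r, (Submodule.Quotient.eq _).2 ?_⟩
    change r • a - x ∈ L
    rw [← hyz, sub_add_cancel_right]
    exact neg_mem hy
  (quotEquivOfEq _ _ hker).trans (φ.quotKerEquivOfSurjective hsurj)

section Chain

variable {M : Type*} [AddCommGroup M] [Module R M] {L L' L'' : Submodule R M}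

/-- The map `L'/L → L''/L` for `L' ≤ L''`. -/
def Submodule.chainInclusion (L : Submodule R M) (h : L' ≤ L'') :
    (L' ⧸ L.submoduleOf L') →ₗ[R] (L'' ⧸ L.submoduleOf L'') :=
  mapQ _ _ (inclusion h) (show _ ≤ comap _ _ from fun _ hx => hx)

/-- The map `L''/L → L''/L'` for `L ≤ L'`. -/
def Submodule.chainProjection (L'' : Submodule R M) (h : L ≤ L') :
    (L'' ⧸ L.submoduleOf L'') →ₗ[R] (L'' ⧸ L'.submoduleOf L'') :=
  mapQ _ _ LinearMap.id (show _ ≤ comap _ _ from fun _ hx => h hx)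

theorem Submodule.chainInclusion_injective (L : Submodule R M) (h : L' ≤ L'') :
    Function.Injective (chainInclusion L h) := by
  rw [injective_iff_map_eq_zero]
  intro x hx
  obtain ⟨x, rfl⟩ := Submodule.Quotient.mk_surjective _ x
  replace hx := (Submodule.Quotient.mk_eq_zero (L.submoduleOf L'') (x := inclusion h x)).1 hx
  exact (Submodule.Quotient.mk_eq_zero _).2 hx

theorem Submodule.chainProjection_surjective (L'' : Submodule R M) (h : L ≤ L') :
    Function.Surjective (chainProjection L'' h) := by
  intro x
  obtain ⟨x, rfl⟩ := Submodule.Quotient.mk_surjective _ x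
  exact ⟨Submodule.Quotient.mk x, rfl⟩

theorem Submodule.exact_chainInclusion_chainProjection (h : L ≤ L') (h' : L' ≤ L'') :
    Function.Exact (chainInclusion L h') (chainProjection L'' h) := by
  intro x
  obtain ⟨x, rfl⟩ := Submodule.Quotient.mk_surjective _ x
  refine (Submodule.Quotient.mk_eq_zero (L'.submoduleOf L'') (x := x)).trans ?_
  constructor
  · intro hx
    exact ⟨Submodule.Quotient.mk ⟨x, hx⟩, rfl⟩
  · rintro ⟨y, hy⟩
    obtain ⟨y, rfl⟩ := Submodule.Quotient.mk_surjective _ y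
    have hy' : (y : M) - x ∈ L :=
      (Submodule.Quotient.eq (L.submoduleOf L'') (x := inclusion h' y)).1 hy
    have hx : (y : M) - (y - x) ∈ L' := sub_mem y.2 (h hy')
    rwa [sub_sub_cancel] at hx

end Chain

end RegularSequences

namespace GradedCM

open RingTheory.Sequence Submodule
open scoped Pointwise

/-! ### Coordinate primes and elementary symmetric polynomials -/

section CoordinateSubspaces

variable {σ : Type*} (k : Type*) [Field k]

/-- The prime ideal `(x_v : v ∉ F)`. -/
noncomputable def coordIdeal (F : Finset σ) : Ideal (MvPolynomial σ k) :=
  RingHom.ker (killCompl (R := k) (Subtype.val_injective (p := (· ∈ F))))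

instance (F : Finset σ) : (coordIdeal k F).IsPrime := RingHom.ker_isPrime _

variable {k}

theorem X_mem_coordIdeal {F : Finset σ} {v : σ} : X v ∈ coordIdeal k F ↔ v ∉ F := by
  rw [coordIdeal, RingHom.mem_ker]
  constructor
  · intro h hv
    have : (X v : MvPolynomial σ k) = rename Subtype.val (X (⟨v, hv⟩ : {x // x ∈ F})) := by
      rw [rename_X]
    rw [this, killCompl_rename_app] at h
    exact X_ne_zero _ h
  · intro hv
    simp [killCompl, hv]

theorem prod_X_mem_coordIdeal {F t : Finset σ} :
    ∏ v ∈ t, X v ∈ coordIdeal k F ↔ ¬ t ⊆ F := by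
  rw [Ideal.IsPrime.prod_mem_iff, Finset.not_subset]
  simp only [X_mem_coordIdeal]

theorem coordIdeal_eq_span (F : Finset σ) :
    coordIdeal k F = Ideal.span (X '' {v | v ∉ F}) := by
  refine le_antisymm (fun f hf => ?_) (Ideal.span_le.2 ?_)
  -- Killing the variables outside `F` changes nothing modulo the ideal they generate; this needs
  -- checking only on variables.
  · have h : ((Ideal.Quotient.mkₐ k (Ideal.span (X '' {v | v ∉ F}))).comp
        (rename Subtype.val)).comp (killCompl (Subtype.val_injective (p := (· ∈ F)))) =
        Ideal.Quotient.mkₐ k (Ideal.span (X '' {v | v ∉ F})) := by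
      refine algHom_ext fun v => ?_
      by_cases hv : v ∈ F
      · have hX : (X v : MvPolynomial σ k) =
            rename Subtype.val (X (⟨v, hv⟩ : {x // x ∈ F})) := by rw [rename_X]
        simp only [AlgHom.comp_apply]
        rw [hX, killCompl_rename_app]
      · have h0 : killCompl (R := k) (Subtype.val_injective (p := (· ∈ F))) (X v) = 0 :=
          RingHom.mem_ker.1 (X_mem_coordIdeal.2 hv)
        simp only [AlgHom.comp_apply, h0, map_zero]
        exact (Ideal.Quotient.eq_zero_iff_mem.2
          (Ideal.subset_span (Set.mem_image_of_mem X hv))).symm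
    have hf' : killCompl (R := k) (Subtype.val_injective (p := (· ∈ F))) f = 0 := hf
    have := congrArg (fun φ => φ f) h
    simp only [AlgHom.comp_apply, hf', map_zero] at this
    exact Ideal.Quotient.eq_zero_iff_mem.1 this.symm
  · rintro _ ⟨v, hv, rfl⟩
    exact X_mem_coordIdeal.2 hv

theorem ringKrullDim_quotient_coordIdeal (F : Finset σ) :
    ringKrullDim (MvPolynomial σ k ⧸ coordIdeal k F) = F.card := by
  have e := RingHom.quotientKerEquivOfSurjective
    (f := (killCompl (R := k) (Subtype.val_injective (p := (· ∈ F)))).toRingHom)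
    fun x => ⟨rename Subtype.val x, killCompl_rename_app _ x⟩
  refine (ringKrullDim_eq_of_ringEquiv e).trans ?_
  rw [MvPolynomial.ringKrullDim_of_isNoetherianRing, ringKrullDim_eq_zero_of_field]
  simp

theorem coordIdeal_sup_span_X [DecidableEq σ] (F : Finset σ) (v : σ) :
    coordIdeal k F ⊔ Ideal.span {X v} = coordIdeal k (F.erase v) := by
  rw [coordIdeal_eq_span, coordIdeal_eq_span, ← Ideal.span_union, ← Set.image_singleton,
    ← Set.image_union]
  congr 2
  ext u
  simp only [Set.mem_union, Set.mem_ofPred_eq, Set.mem_singleton_iff, Finset.mem_erase]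
  tauto

theorem coordIdeal_le_irrelevantIdeal (F : Finset σ) : coordIdeal k F ≤ irrelevantIdeal σ k := by
  rw [coordIdeal_eq_span]
  exact Ideal.span_mono (Set.image_subset_range _ _)

theorem irrelevantIdeal_ne_top : irrelevantIdeal σ k ≠ ⊤ := by
  have h : irrelevantIdeal σ k = coordIdeal k ∅ := by
    rw [coordIdeal_eq_span, irrelevantIdeal]
    simp
  rw [h]
  exact Ideal.IsPrime.ne_top inferInstance

theorem isSMulRegular_quotient_of_notMem {R : Type*} [CommRing R] {P : Ideal R} [P.IsPrime]
    {a : R} (ha : a ∉ P) : IsSMulRegular (R ⧸ P) a := by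
  rw [isSMulRegular_quotient_iff_mem_of_smul_mem]
  exact fun x hx => (Ideal.IsPrime.mem_or_mem ‹_› hx).resolve_left ha

/-- `M/aM ≅ R/(P + (a))` for `M = R/P`. -/
noncomputable def quotSMulTopQuotientEquiv {R : Type*} [CommRing R] (P : Ideal R) (a : R) :
    QuotSMulTop a (R ⧸ P) ≃ₗ[R] (R ⧸ (P ⊔ Ideal.span {a})) :=
  (quotEquivOfEq _ _ (by
    rw [← ideal_span_singleton_smul, ← range_mkQ, ← Submodule.map_top, ← Submodule.map_smul'',
      smul_eq_mul, Ideal.mul_top])).trans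
    (quotientQuotientEquivQuotientSup P (Ideal.span {a}))

variable (σ k) in
/-- The elementary symmetric polynomials `e_d, …, e_1`. -/
noncomputable def esymmSeq [Fintype σ] : ℕ → List (MvPolynomial σ k)
  | 0 => []
  | d + 1 => esymm σ k (d + 1) :: esymmSeq d

theorem length_esymmSeq [Fintype σ] (d : ℕ) : (esymmSeq σ k d).length = d := by
  induction d with
  | zero => rfl
  | succ d ih => rw [esymmSeq, List.length_cons, ih]

theorem mem_irrelevantIdeal_of_mem_esymmSeq [Fintype σ] {d : ℕ} {f : MvPolynomial σ k}
    (hf : f ∈ esymmSeq σ k d) : f ∈ irrelevantIdeal σ k := by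
  induction d with
  | zero => simp [esymmSeq] at hf
  | succ d ih =>
    rw [esymmSeq, List.mem_cons] at hf
    rcases hf with rfl | hf
    · refine sum_mem fun t ht => ?_
      obtain ⟨v, hv⟩ : t.Nonempty := by
        rw [← Finset.card_pos, (Finset.mem_powersetCard.1 ht).2]
        exact d.succ_pos
      exact Ideal.mem_of_dvd _ (Finset.dvd_prod_of_mem X hv) (Ideal.subset_span ⟨v, rfl⟩)
    · exact ih hf

/-- Every other squarefree monomial of degree `|F|` involves a variable outside `F`. -/
theorem esymm_sub_prod_mem_coordIdeal [Fintype σ] (F : Finset σ) :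
    esymm σ k F.card - ∏ v ∈ F, X v ∈ coordIdeal k F := by
  classical
  have hF : F ∈ Finset.powersetCard F.card Finset.univ :=
    Finset.mem_powersetCard.2 ⟨Finset.subset_univ _, rfl⟩
  rw [esymm, ← Finset.add_sum_erase _ _ hF, add_sub_cancel_left]
  refine sum_mem fun t ht => prod_X_mem_coordIdeal.2 fun h => ?_
  obtain ⟨hne, ht⟩ := Finset.mem_erase.1 ht
  exact hne (Finset.eq_of_subset_of_card_le h (Finset.mem_powersetCard.1 ht).2.ge)

/-- On `S/P_F` with `|F| = d`, `e_d` acts as the product of the variables in `F`, a nonzerodivisor.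
The quotient by this product is an iterated extension of the rings `S/P_{F∖v}`, `v ∈ F`, to which
induction applies. The sequence depends only on `d`, not on `F`, which lets it serve for extensions
of several such rings. -/
theorem isWeaklyRegular_esymmSeq [Fintype σ] (F : Finset σ) :
    IsWeaklyRegular (MvPolynomial σ k ⧸ coordIdeal k F) (esymmSeq σ k F.card) := by
  classical
  induction hd : F.card generalizing F with
  | zero => exact .nil _ _
  | succ d ih =>
    have hsmul (x : MvPolynomial σ k ⧸ coordIdeal k F) :
        esymm σ k (d + 1) • x = (∏ v ∈ F, X v : MvPolynomial σ k) • x := by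
      obtain ⟨x, rfl⟩ := Submodule.Quotient.mk_surjective _ x
      rw [← Submodule.Quotient.mk_smul, ← Submodule.Quotient.mk_smul, Submodule.Quotient.eq,
        ← sub_smul, ← hd]
      exact Ideal.mul_mem_right _ _ (esymm_sub_prod_mem_coordIdeal F)
    refine .cons (fun x y hxy => ?_) ?_
    · refine isSMulRegular_quotient_of_notMem (P := coordIdeal k F) (a := ∏ v ∈ F, X v)
        (fun h => prod_X_mem_coordIdeal.1 h subset_rfl) ?_
      simpa only [hsmul] using hxy
    · have htop : esymm σ k (d + 1) • (⊤ : Submodule (MvPolynomial σ k)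
          (MvPolynomial σ k ⧸ coordIdeal k F)) = (∏ v ∈ F, X v : MvPolynomial σ k) • ⊤ := by
        ext x
        simp only [mem_smul_pointwise_iff_exists, hsmul]
      rw [(quotEquivOfEq _ _ htop).isWeaklyRegular_congr]
      refine .quotSMulTop_prod F X (fun v hv => isSMulRegular_quotient_of_notMem
        fun h => X_mem_coordIdeal.1 h hv) fun v hv => ?_
      rw [((quotSMulTopQuotientEquiv (coordIdeal k F) (X v)).trans
        (quotEquivOfEq _ _ (coordIdeal_sup_span_X F v))).isWeaklyRegular_congr]
      exact ih _ (by rw [Finset.card_erase_of_mem hv, hd, Nat.add_sub_cancel])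

/-- Equality would pass to the quotient `S/P_F`, which is impossible because `P_F` lies in the
proper ideal generated by the variables. This is what upgrades weakly regular sequences to regular
ones. -/
theorem irrelevantIdeal_smul_top_ne_top_of_surjective {M : Type*} [AddCommGroup M]
    [Module (MvPolynomial σ k) M] {F : Finset σ}
    (g : M →ₗ[MvPolynomial σ k] (MvPolynomial σ k ⧸ coordIdeal k F))
    (hg : Function.Surjective g) :
    irrelevantIdeal σ k • (⊤ : Submodule (MvPolynomial σ k) M) ≠ ⊤ := by
  intro h
  have h' := congrArg (Submodule.map g) h
  rw [Submodule.map_smul'', Submodule.map_top, LinearMap.range_eq_top.2 hg, ← range_mkQ,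
    ← Submodule.map_top, ← Submodule.map_smul'', smul_eq_mul, Ideal.mul_top] at h'
  have h1 : (coordIdeal k F).mkQ 1 ∈ Submodule.map (coordIdeal k F).mkQ (irrelevantIdeal σ k) :=
    h' ▸ ⟨1, trivial, rfl⟩
  obtain ⟨f, hf, hf1⟩ := h1
  rw [mkQ_apply, mkQ_apply, Submodule.Quotient.eq] at hf1
  refine irrelevantIdeal_ne_top (σ := σ) (k := k) ((Ideal.eq_top_iff_one _).2 ?_)
  have := sub_mem hf (coordIdeal_le_irrelevantIdeal F hf1)
  rwa [sub_sub_cancel] at this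

end CoordinateSubspaces

/-! ### Iterated extensions of equidimensional coordinate rings -/

section Pure

variable {σ : Type*} [Fintype σ] {k : Type*} [Field k]

/-- The properties that an iterated extension of modules `S/(x_v : v ∉ F)` with `|F| = d`
inherits from these modules. -/
structure IsPureOfDim (σ : Type*) [Fintype σ] (k : Type*) [Field k] (d : ℕ) (M : Type*) [AddCommGroup M]
    [Module (MvPolynomial σ k) M] : Prop where
  isWeaklyRegular : IsWeaklyRegular M (esymmSeq σ k d)
  exists_le : ∀ p ∈ Module.support (MvPolynomial σ k) M,
    ∃ F : Finset σ, F.card = d ∧ coordIdeal k F ≤ p.asIdeal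

variable {d : ℕ} {M M' M'' : Type*} [AddCommGroup M] [Module (MvPolynomial σ k) M]
  [AddCommGroup M'] [Module (MvPolynomial σ k) M'] [AddCommGroup M'']
  [Module (MvPolynomial σ k) M'']

theorem isPureOfDim_quotient_coordIdeal (F : Finset σ) :
    IsPureOfDim σ k F.card (MvPolynomial σ k ⧸ coordIdeal k F) where
  isWeaklyRegular := isWeaklyRegular_esymmSeq F
  exists_le p hp := by
    have h := Module.annihilator_le_of_mem_support hp
    rw [Ideal.annihilator_quotient] at h
    exact ⟨F, rfl, h⟩

theorem IsPureOfDim.of_subsingleton [Subsingleton M] : IsPureOfDim σ k d M where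
  isWeaklyRegular := .of_subsingleton _
  exists_le p hp := by simp [Module.support_eq_empty] at hp

theorem IsPureOfDim.of_equiv (e : M ≃ₗ[MvPolynomial σ k] M') (h : IsPureOfDim σ k d M) :
    IsPureOfDim σ k d M' where
  isWeaklyRegular := (e.isWeaklyRegular_congr _).1 h.isWeaklyRegular
  exists_le p hp := h.exists_le p (e.support_eq ▸ hp)

theorem IsPureOfDim.of_exact {f : M →ₗ[MvPolynomial σ k] M'} {g : M' →ₗ[MvPolynomial σ k] M''}
    (hf : Function.Injective f) (hg : Function.Surjective g) (hfg : Function.Exact f g)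
    (h : IsPureOfDim σ k d M) (h'' : IsPureOfDim σ k d M'') : IsPureOfDim σ k d M' where
  isWeaklyRegular := .of_exact hf hg hfg h.isWeaklyRegular h''.isWeaklyRegular
  exists_le p hp := by
    rw [Module.support_of_exact hfg hf hg] at hp
    exact hp.elim (h.exists_le p) (h''.exists_le p)

theorem IsPureOfDim.supportDim_le (h : IsPureOfDim σ k d M) :
    Module.supportDim (MvPolynomial σ k) M ≤ d := by
  refine iSup_le fun p => ?_
  -- The smallest prime of the chain contains some `P_F`, so the whole chain lives in the spectrum
  -- of `S/P_F`.
  obtain ⟨F, rfl, hF⟩ := h.exists_le _ p.head.2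
  rw [← ringKrullDim_quotient_coordIdeal (k := k) F, ringKrullDim_quotient]
  let q : LTSeries (PrimeSpectrum.zeroLocus (coordIdeal k F : Set (MvPolynomial σ k))) :=
    { length := p.length
      toFun := fun i => ⟨(p i).1, hF.trans (p.monotone (Fin.zero_le i))⟩
      step := fun i => p.step i }
  exact le_iSup (fun q : LTSeries (PrimeSpectrum.zeroLocus
    (coordIdeal k F : Set (MvPolynomial σ k))) => (q.length : WithBot ℕ∞)) q

theorem IsPureOfDim.isRegular (h : IsPureOfDim σ k d M)
    (hM : irrelevantIdeal σ k • (⊤ : Submodule (MvPolynomial σ k) M) ≠ ⊤) :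
    IsRegular M (esymmSeq σ k d) where
  toIsWeaklyRegular := h.isWeaklyRegular
  top_ne_smul h' := hM <| top_le_iff.1 <| h'.le.trans <| Submodule.smul_mono_left <|
    Ideal.span_le.2 fun _ hf => mem_irrelevantIdeal_of_mem_esymmSeq hf

variable [Module.Finite (MvPolynomial σ k) M]

theorem IsPureOfDim.supportDim_eq (h : IsPureOfDim σ k d M)
    (hM : irrelevantIdeal σ k • (⊤ : Submodule (MvPolynomial σ k) M) ≠ ⊤) :
    Module.supportDim (MvPolynomial σ k) M = d := by
  refine le_antisymm h.supportDim_le ?_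
  simpa only [length_esymmSeq] using Module.length_le_supportDim_of_isRegular (h.isRegular hM)

theorem IsPureOfDim.isCohenMacaulay (h : IsPureOfDim σ k d M)
    (hM : irrelevantIdeal σ k • (⊤ : Submodule (MvPolynomial σ k) M) ≠ ⊤) :
    IsCohenMacaulay σ k M := by
  refine .inr ?_
  rw [h.supportDim_eq hM]
  refine le_antisymm ?_ ?_
  -- No regular sequence is longer than the dimension; for the converse bound, the elementary
  -- symmetric polynomials attain it.
  · refine WithBot.coe_le_coe.2 (iSup_le fun rs => ?_)
    have := (Module.length_le_supportDim_of_isRegular rs.2.2).trans h.supportDim_le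
    exact_mod_cast this
  · refine WithBot.coe_le_coe.2 ?_
    refine le_trans ?_ (le_iSup _ ⟨esymmSeq σ k d,
      fun _ => mem_irrelevantIdeal_of_mem_esymmSeq, h.isRegular hM⟩)
    rw [length_esymmSeq]

end Pure

end GradedCM

namespace GradedCM

attribute [local instance] MvPolynomial.gradedAlgebra in
theorem isHomogeneous_map_mkQ {σ k : Type*} [Field k] (I J : Ideal (MvPolynomial σ k))
    (hI : I.IsHomogeneous (homogeneousSubmodule σ k))
    (hJ : J.IsHomogeneous (homogeneousSubmodule σ k)) :
    letI := quotientDecomposition I hI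
    (Submodule.map I.mkQ J).IsHomogeneous (quotientGrading I) := by
  rintro d _ ⟨f, hf, rfl⟩
  exact ⟨_, hJ d hf, rfl⟩

end GradedCM

namespace SimpleGraph

open GradedCM Submodule

/-! ### The filtration by independent sets of `G` -/

section Filtration

variable {V : Type*} (G : SimpleGraph V) {r : ℕ} (W : Fin r → Set V)
  (n : Fin r → ℕ) (k : Type*) [Field k]

open Classical in
/-- The facet of the independence complex of the multi-clique-whiskered graph that meets `V(G)` in
the independent set `A`. -/
noncomputable def whiskerFacet (A : Finset V) : Finset (V ⊕ (Σ i : Fin r, Fin (n i))) :=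
  A.disjSum {w | ∀ a ∈ A, a ∉ W w.1}

/-- The ideal generated by the edge ideal of the multi-clique-whiskered graph and the monomials
`∏_{a ∈ A} x_a` with `A ∈ U`. -/
noncomputable def whiskerIdeal (U : Finset (Finset V)) :
    Ideal (MvPolynomial (V ⊕ (Σ i : Fin r, Fin (n i))) k) :=
  (G.multiCliqueWhisker W n).edgeIdeal k ⊔
    Ideal.span ((fun A : Finset V => ∏ a ∈ A, X (Sum.inl a)) '' U)

/-- The image of `whiskerIdeal` modulo the edge ideal. -/
noncomputable def whiskerSubmodule (U : Finset (Finset V)) :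
    Submodule (MvPolynomial (V ⊕ (Σ i : Fin r, Fin (n i))) k)
      (MvPolynomial (V ⊕ (Σ i : Fin r, Fin (n i))) k ⧸
        (G.multiCliqueWhisker W n).edgeIdeal k) :=
  Submodule.map ((G.multiCliqueWhisker W n).edgeIdeal k).mkQ (whiskerIdeal G W n k U)

/-- `U` consists of independent sets, and contains every independent set that contains a
member of `U`. -/
def IsUpperFamily (U : Finset (Finset V)) : Prop :=
  (∀ A ∈ U, G.IsIndepSet (A : Set V)) ∧
    ∀ A ∈ U, ∀ B : Finset V, A ⊆ B → G.IsIndepSet (B : Set V) → B ∈ U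

variable {G W n k}

theorem inl_mem_whiskerFacet {A : Finset V} {v : V} :
    Sum.inl v ∈ whiskerFacet W n A ↔ v ∈ A := by
  rw [whiskerFacet, Finset.inl_mem_disjSum]

theorem inr_mem_whiskerFacet {A : Finset V} {w : Σ i : Fin r, Fin (n i)} :
    Sum.inr w ∈ whiskerFacet W n A ↔ ∀ a ∈ A, a ∉ W w.1 := by
  classical
  rw [whiskerFacet, Finset.inr_mem_disjSum, Finset.mem_filter_univ]

theorem isIndepSet_whiskerFacet {A : Finset V} (hA : G.IsIndepSet (A : Set V)) :
    (G.multiCliqueWhisker W n).IsIndepSet (whiskerFacet W n A : Set _) := by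
  rintro (u | u) hu (v | v) hv huv
  · rw [Finset.mem_coe, inl_mem_whiskerFacet] at hu hv
    exact hA hu hv fun h => huv (h ▸ rfl)
  · rw [Finset.mem_coe, inl_mem_whiskerFacet] at hu
    exact inr_mem_whiskerFacet.1 hv u hu
  · rw [Finset.mem_coe, inl_mem_whiskerFacet] at hv
    exact inr_mem_whiskerFacet.1 hu v hv
  · exact id

/-- Each vertex of `B ∖ A` is traded for the first whisker at its clique. An independent set meets a
clique at most once, so `A` misses that clique and the whisker lies in the facet of `A`. For the
same reason the trade is injective, and no whisker obtained this way was already in the facet of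
`B`. -/
theorem card_whiskerFacet_le (hW : G.IsCliquePartition W) (hn : ∀ i, 0 < n i)
    {A B : Finset V} (hAB : A ⊆ B) (hB : G.IsIndepSet (B : Set V)) :
    (whiskerFacet W n B).card ≤ (whiskerFacet W n A).card := by
  classical
  have hcover (v : V) : ∃ i, v ∈ W i := Set.mem_iUnion.1 (hW.iUnion_eq ▸ Set.mem_univ v)
  choose c hc using hcover
  have heq {a b : V} (ha : a ∈ B) (hb : b ∈ B) {i : Fin r} (hai : a ∈ W i) (hbi : b ∈ W i) :
      a = b := by
    by_contra hab
    exact hB ha hb hab (hW.isClique i hai hbi hab)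
  refine Finset.card_le_card_of_injOn
    (Sum.elim (fun v => if v ∈ A then Sum.inl v else Sum.inr ⟨c v, 0, hn _⟩) Sum.inr) ?_ ?_
  · rintro (v | w) hv
    · have hv := inl_mem_whiskerFacet.1 hv
      simp only [Sum.elim_inl]
      split_ifs with hvA
      · exact inl_mem_whiskerFacet.2 hvA
      · refine inr_mem_whiskerFacet.2 fun a ha hac => hvA ?_
        rwa [heq hv (hAB ha) (hc v) hac]
    · exact inr_mem_whiskerFacet.2 fun a ha => inr_mem_whiskerFacet.1 hv a (hAB ha)
  · rintro (u | w) hu (v | w') hv huv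
    · have hu := inl_mem_whiskerFacet.1 hu
      have hv := inl_mem_whiskerFacet.1 hv
      simp only [Sum.elim_inl] at huv
      split_ifs at huv
      · exact huv
      · have h : c u = c v := congrArg Sigma.fst (Sum.inr_injective huv)
        rw [heq hu hv (hc u) (h ▸ hc v)]
    · have hu := inl_mem_whiskerFacet.1 hu
      simp only [Sum.elim_inl, Sum.elim_inr] at huv
      split_ifs at huv
      rw [← Sum.inr_injective huv] at hv
      exact absurd (hc u) (inr_mem_whiskerFacet.1 hv u hu)
    · have hv := inl_mem_whiskerFacet.1 hv
      simp only [Sum.elim_inl, Sum.elim_inr] at huv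
      split_ifs at huv
      rw [Sum.inr_injective huv] at hu
      exact absurd (hc v) (inr_mem_whiskerFacet.1 hu v hv)
    · exact huv

theorem edgeIdeal_le_coordIdeal {α : Type*} {H : SimpleGraph α} {F : Finset α}
    (hF : H.IsIndepSet (F : Set α)) : H.edgeIdeal k ≤ coordIdeal k F := by
  refine Ideal.span_le.2 ?_
  rintro _ ⟨u, v, huv, rfl⟩
  by_cases hu : u ∈ F
  · exact Ideal.mul_mem_left _ _ (X_mem_coordIdeal.2 fun hv => hF hu hv huv.ne huv)
  · exact Ideal.mul_mem_right _ _ (X_mem_coordIdeal.2 hu)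

theorem X_mul_prod_mem_edgeIdeal {v : V ⊕ (Σ i : Fin r, Fin (n i))} {A : Finset V} {a : V}
    (ha : a ∈ A) (h : (G.multiCliqueWhisker W n).Adj v (Sum.inl a)) :
    X v * ∏ a ∈ A, X (Sum.inl a) ∈ (G.multiCliqueWhisker W n).edgeIdeal k :=
  Ideal.mem_of_dvd _ (mul_dvd_mul_left _ (Finset.dvd_prod_of_mem _ ha))
    (Ideal.subset_span ⟨v, Sum.inl a, h, rfl⟩)

theorem mkQ_mem_whiskerSubmodule_iff {U : Finset (Finset V)}
    {f : MvPolynomial (V ⊕ (Σ i : Fin r, Fin (n i))) k} :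
    ((G.multiCliqueWhisker W n).edgeIdeal k).mkQ f ∈ whiskerSubmodule G W n k U ↔
      f ∈ whiskerIdeal G W n k U := by
  have hle : (G.multiCliqueWhisker W n).edgeIdeal k ≤ whiskerIdeal G W n k U := le_sup_left
  rw [whiskerSubmodule, ← Submodule.mem_comap, Submodule.comap_map_mkQ, sup_eq_right.2 hle]

theorem whiskerSubmodule_mono {U U' : Finset (Finset V)} (h : U ⊆ U') :
    whiskerSubmodule G W n k U ≤ whiskerSubmodule G W n k U' :=
  Submodule.map_mono (sup_le_sup_left
    (Ideal.span_mono (Set.image_mono (Finset.coe_subset.2 h))) _)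

attribute [local instance] MvPolynomial.gradedAlgebra in
theorem whiskerIdeal_isHomogeneous (U : Finset (Finset V)) :
    (whiskerIdeal G W n k U).IsHomogeneous (homogeneousSubmodule _ k) := by
  refine (edgeIdeal_isHomogeneous k _).sup (Ideal.homogeneous_span _ _ ?_)
  rintro _ ⟨A, -, rfl⟩
  exact ⟨_, IsHomogeneous.prod _ _ (fun _ => 1) fun a _ => isHomogeneous_X k _⟩

variable [DecidableEq V]

theorem whiskerIdeal_insert (U : Finset (Finset V)) (A : Finset V) :
    whiskerIdeal G W n k (insert A U) =
      whiskerIdeal G W n k U ⊔ Ideal.span {∏ a ∈ A, X (Sum.inl a)} := by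
  rw [whiskerIdeal, whiskerIdeal, Finset.coe_insert, Set.image_insert_eq, Ideal.span_insert,
    sup_assoc, sup_comm (Ideal.span {_})]

/-- The colon ideal of `∏_{a ∈ A} x_a` is generated by the variables outside the facet of `A`. -/
theorem mul_prod_mem_whiskerIdeal_iff {U : Finset (Finset V)} (hU : G.IsUpperFamily U)
    {A : Finset V} (hA : G.IsIndepSet (A : Set V)) (hAU : A ∉ U)
    (hmax : ∀ B : Finset V, A ⊂ B → G.IsIndepSet (B : Set V) → B ∈ U)
    (f : MvPolynomial (V ⊕ (Σ i : Fin r, Fin (n i))) k) :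
    f * ∏ a ∈ A, X (Sum.inl a) ∈ whiskerIdeal G W n k U ↔
      f ∈ coordIdeal k (whiskerFacet W n A) := by
  have hprod (B : Finset V) : ∏ a ∈ B, X (Sum.inl a) ∈ coordIdeal k (whiskerFacet W n A) ↔
      ¬ B ⊆ A := by
    rw [Ideal.IsPrime.prod_mem_iff, Finset.not_subset]
    simp only [X_mem_coordIdeal, inl_mem_whiskerFacet]
  constructor
  · intro hf
    have hle : whiskerIdeal G W n k U ≤ coordIdeal k (whiskerFacet W n A) := by
      refine sup_le (edgeIdeal_le_coordIdeal (isIndepSet_whiskerFacet hA)) (Ideal.span_le.2 ?_)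
      rintro _ ⟨B, hB, rfl⟩
      exact (hprod B).2 fun h => hAU (hU.2 B hB A h hA)
    exact (Ideal.IsPrime.mem_or_mem inferInstance (hle hf)).resolve_right
      fun h => (hprod A).1 h subset_rfl
  · suffices h : coordIdeal k (whiskerFacet W n A) ≤ Submodule.comap
        (LinearMap.toSpanSingleton _ (MvPolynomial (V ⊕ (Σ i : Fin r, Fin (n i))) k)
          (∏ a ∈ A, X (Sum.inl a))) (whiskerIdeal G W n k U) from fun hf => h hf
    rw [coordIdeal_eq_span]
    refine Submodule.span_le.2 ?_
    rintro _ ⟨v, hv, rfl⟩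
    change X v * ∏ a ∈ A, X (Sum.inl a) ∈ whiskerIdeal G W n k U
    rcases v with b | w
    · have hb : b ∉ A := fun h => hv (inl_mem_whiskerFacet.2 h)
      by_cases hbA : ∀ a ∈ A, ¬ G.Adj b a
      -- Here `A ∪ {b}` is independent, so by maximality its monomial is already a generator; in the
      -- remaining cases an edge divides the product.
      · refine Ideal.mem_sup_right (Ideal.subset_span ⟨insert b A, ?_, Finset.prod_insert hb⟩)
        exact hmax _ (Finset.ssubset_insert hb) (isIndepSet_insert_iff.2 ⟨hA, hbA⟩)
      · push Not at hbA
        obtain ⟨a, ha, hab⟩ := hbA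
        exact Ideal.mem_sup_left (X_mul_prod_mem_edgeIdeal ha hab)
    · have hw : ¬ ∀ a ∈ A, a ∉ W w.1 := fun h => hv (inr_mem_whiskerFacet.2 h)
      push Not at hw
      obtain ⟨a, ha, haw⟩ := hw
      exact Ideal.mem_sup_left (X_mul_prod_mem_edgeIdeal ha haw)

/-- An upper family that strictly contains another one can be shrunk by one member `A`, and the
quotient of the two submodules is the coordinate ring of the facet of `A`. -/
theorem IsUpperFamily.exists_erase {U U' : Finset (Finset V)} (hU : G.IsUpperFamily U)
    (hU' : G.IsUpperFamily U') (h : U ⊂ U') :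
    ∃ A ∈ U', A ∉ U ∧ G.IsUpperFamily (U'.erase A) ∧
      Nonempty ((MvPolynomial (V ⊕ (Σ i : Fin r, Fin (n i))) k ⧸
          coordIdeal k (whiskerFacet W n A)) ≃ₗ[MvPolynomial (V ⊕ (Σ i : Fin r, Fin (n i))) k]
        (whiskerSubmodule G W n k U' ⧸
          (whiskerSubmodule G W n k (U'.erase A)).submoduleOf (whiskerSubmodule G W n k U'))) := by
  -- Minimality of `A` keeps `U'.erase A` upward closed: a member strictly below `A` would have to
  -- lie in `U`, forcing `A ∈ U`.
  obtain ⟨A, hA⟩ := (U' \ U).exists_minimal (Finset.sdiff_nonempty.2 h.2)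
  obtain ⟨hAU', hAU⟩ := Finset.mem_sdiff.1 hA.1
  have hup : G.IsUpperFamily (U'.erase A) := by
    refine ⟨fun B hB => hU'.1 B (Finset.mem_of_mem_erase hB), fun B hB C hBC hC => ?_⟩
    obtain ⟨hBA, hBU'⟩ := Finset.mem_erase.1 hB
    refine Finset.mem_erase.2 ⟨?_, hU'.2 B hBU' C hBC hC⟩
    rintro rfl
    by_cases hBU : B ∈ U
    · exact hAU (hU.2 B hBU _ hBC hC)
    · exact hBA (hBC.antisymm (hA.2 (Finset.mem_sdiff.2 ⟨hBU', hBU⟩) hBC))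
  refine ⟨A, hAU', hAU, hup, ⟨quotientEquivOfSupSpan
    (a := ((G.multiCliqueWhisker W n).edgeIdeal k).mkQ (∏ a ∈ A, X (Sum.inl a))) ?_ fun f => ?_⟩⟩
  · conv_lhs => rw [← Finset.insert_erase hAU']
    rw [whiskerSubmodule, whiskerIdeal_insert, Submodule.map_sup, Ideal.span, Submodule.map_span,
      Set.image_singleton]
    rfl
  · rw [← map_smul, mkQ_mem_whiskerSubmodule_iff, smul_eq_mul]
    exact mul_prod_mem_whiskerIdeal_iff hup (hU'.1 A hAU') (Finset.notMem_erase _ _)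
      (fun B hAB hB => Finset.mem_erase.2 ⟨hAB.ne', hU'.2 A hAU' B hAB.1 hB⟩) f

theorem irrelevantIdeal_smul_top_ne_top_whiskerSubmodule {U U' : Finset (Finset V)}
    (hU : G.IsUpperFamily U) (hU' : G.IsUpperFamily U') (h : U ⊂ U') :
    irrelevantIdeal (V ⊕ (Σ i : Fin r, Fin (n i))) k •
      (⊤ : Submodule (MvPolynomial (V ⊕ (Σ i : Fin r, Fin (n i))) k) (whiskerSubmodule G W n k U' ⧸
        (whiskerSubmodule G W n k U).submoduleOf (whiskerSubmodule G W n k U'))) ≠ ⊤ := by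
  obtain ⟨A, -, hAU, -, ⟨e⟩⟩ := hU.exists_erase (W := W) (n := n) (k := k) hU' h
  exact irrelevantIdeal_smul_top_ne_top_of_surjective
    (e.symm.toLinearMap ∘ₗ chainProjection _
      (whiskerSubmodule_mono (Finset.subset_erase.2 ⟨h.1, hAU⟩)))
    (e.symm.surjective.comp (chainProjection_surjective _ _))

variable [Fintype V]

/-- Members of `U' ∖ U` are removed one at a time, each removal splitting off the coordinate ring of
a facet with `d` elements. -/
theorem isPureOfDim_whiskerSubmodule {U U' : Finset (Finset V)} (hU : G.IsUpperFamily U)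
    (hU' : G.IsUpperFamily U') (h : U ⊆ U') {d : ℕ}
    (hd : ∀ A ∈ U', A ∉ U → (whiskerFacet W n A).card = d) :
    IsPureOfDim (V ⊕ (Σ i : Fin r, Fin (n i))) k d (whiskerSubmodule G W n k U' ⧸
      (whiskerSubmodule G W n k U).submoduleOf (whiskerSubmodule G W n k U')) := by
  induction hm : U'.card using Nat.strong_induction_on generalizing U' with
  | _ m ih =>
  subst hm
  rcases eq_or_ssubset_of_subset h with rfl | hss
  · have : Subsingleton (whiskerSubmodule G W n k U ⧸
        (whiskerSubmodule G W n k U).submoduleOf (whiskerSubmodule G W n k U)) := by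
      rw [Submodule.Quotient.subsingleton_iff, Submodule.submoduleOf_self]
    exact .of_subsingleton
  · obtain ⟨A, hAU', hAU, hup, ⟨e⟩⟩ := hU.exists_erase (W := W) (n := n) (k := k) hU' hss
    have hle : U ⊆ U'.erase A := Finset.subset_erase.2 ⟨h, hAU⟩
    refine .of_exact (chainInclusion_injective _ (whiskerSubmodule_mono (Finset.erase_subset _ _)))
      (chainProjection_surjective _ (whiskerSubmodule_mono hle))
      (exact_chainInclusion_chainProjection _ _)
      (ih _ (Finset.card_erase_lt_of_mem hAU') hup hle
        (fun B hB => hd B (Finset.mem_of_mem_erase hB)) rfl) ?_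
    rw [← hd A hAU' hAU]
    exact (isPureOfDim_quotient_coordIdeal _).of_equiv e

end Filtration

/-! ### Grouping the filtration by facet size -/

theorem isSequentiallyCohenMacaulay_multiCliqueWhisker {V : Type*} [Fintype V] [DecidableEq V]
    {G : SimpleGraph V} {r : ℕ} {W : Fin r → Set V} (hW : G.IsCliquePartition W)
    {n : Fin r → ℕ} (hn : ∀ i, 0 < n i) (k : Type*) [Field k] :
    (G.multiCliqueWhisker W n).IsSequentiallyCohenMacaulay k := by
  classical
  let c (A : Finset V) : ℕ := (whiskerFacet W n A).card
  let I : Finset (Finset V) := {A | G.IsIndepSet (A : Set V)}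
  have mem_I {A : Finset V} : A ∈ I ↔ G.IsIndepSet (A : Set V) := by simp [I]
  -- The distinct facet sizes, enumerated increasingly by `e`, are the dimensions of the layers.
  let D : Finset ℕ := I.image c
  let e : Fin D.card ↪o ℕ := D.orderEmbOfFin rfl
  have he {A : Finset V} (hA : G.IsIndepSet (A : Set V)) : ∃ i, c A = e i := by
    have hcA : c A ∈ Set.range e := by
      rw [Finset.range_orderEmbOfFin]
      exact Finset.mem_image_of_mem c (mem_I.2 hA)
    obtain ⟨i, hi⟩ := hcA
    exact ⟨i, hi.symm⟩
  -- The independent sets whose facet has one of the `j` smallest sizes. Enlarging the set can only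
  -- shrink the facet, so this family is upward closed.
  let U (j : ℕ) : Finset (Finset V) := {A ∈ I | ∃ i, i.1 < j ∧ c A = e i}
  have mem_U {j : ℕ} {A : Finset V} :
      A ∈ U j ↔ G.IsIndepSet (A : Set V) ∧ ∃ i, i.1 < j ∧ c A = e i := by
    rw [Finset.mem_filter, mem_I]
  have hup (j : ℕ) : G.IsUpperFamily (U j) := by
    refine ⟨fun A hA => (mem_U.1 hA).1, fun A hA B hAB hB => mem_U.2 ⟨hB, ?_⟩⟩
    obtain ⟨-, i, hij, hi⟩ := mem_U.1 hA
    obtain ⟨i', hi'⟩ := he hB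
    have hle : c B ≤ c A := card_whiskerFacet_le hW hn hAB hB
    rw [hi, hi', e.le_iff_le] at hle
    exact ⟨i', lt_of_le_of_lt hle hij, hi'⟩
  have hss (j : ℕ) (hj : j < D.card) : U j ⊂ U (j + 1) := by
    refine (Finset.ssubset_iff_of_subset fun A hA => ?_).2 ?_
    · obtain ⟨hA, i, hij, hi⟩ := mem_U.1 hA
      exact mem_U.2 ⟨hA, i, by lia, hi⟩
    · obtain ⟨A, hA, hAj⟩ := Finset.mem_image.1 (D.orderEmbOfFin_mem rfl ⟨j, hj⟩)
      refine ⟨A, mem_U.2 ⟨mem_I.1 hA, ⟨j, hj⟩, j.lt_succ_self, hAj⟩, ?_⟩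
      intro hA'
      obtain ⟨-, i, hij, hi⟩ := mem_U.1 hA'
      have : i = ⟨j, hj⟩ := e.injective (hi.symm.trans hAj)
      rw [this] at hij
      exact lt_irrefl _ hij
  have hpure (j : ℕ) (hj : j < D.card) := isPureOfDim_whiskerSubmodule (W := W) (n := n) (k := k)
    (hup j) (hup (j + 1)) (hss j hj).1 (d := e ⟨j, hj⟩) (by
      intro A hA hA'
      obtain ⟨hA, i, hij, hi⟩ := mem_U.1 hA
      have hji : i.1 = j := by
        by_contra hne
        exact hA' (mem_U.2 ⟨hA, i, by lia, hi⟩)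
      rw [← show i = ⟨j, hj⟩ from Fin.ext hji]
      exact hi)
  have hne (j : ℕ) (hj : j < D.card) := irrelevantIdeal_smul_top_ne_top_whiskerSubmodule
    (W := W) (n := n) (k := k) (hup j) (hup (j + 1)) (hss j hj)
  refine ⟨D.card, fun j => whiskerSubmodule G W n k (U j), ?_, ?_, fun j _ => ?_, fun j hj => ?_,
    fun j hj => (hpure j hj).isCohenMacaulay (hne j hj), fun j hj => ?_⟩
  · have hU : U 0 = ∅ := Finset.eq_empty_of_forall_notMem fun A hA => by
      obtain ⟨-, i, hi, -⟩ := mem_U.1 hA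
      exact absurd hi i.1.not_lt_zero
    simp only [hU, whiskerSubmodule, whiskerIdeal, Finset.coe_empty, Set.image_empty,
      Ideal.span_empty, sup_bot_eq, mkQ_map_self]
  -- The empty set contributes the empty product `1`, so the last ideal is the whole ring.
  · have h0 : G.IsIndepSet ((∅ : Finset V) : Set V) := by simp [IsIndepSet]
    have hmem : (∅ : Finset V) ∈ U D.card := by
      obtain ⟨i, hi⟩ := he h0
      exact mem_U.2 ⟨h0, i, i.2, hi⟩
    have htop : whiskerIdeal G W n k (U D.card) = ⊤ :=
      (Ideal.eq_top_iff_one _).2 (Ideal.mem_sup_right (Ideal.subset_span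
        ⟨∅, hmem, Finset.prod_empty⟩))
    simp only [whiskerSubmodule, htop, Submodule.map_top, range_mkQ]
  · exact isHomogeneous_map_mkQ _ _ (edgeIdeal_isHomogeneous k _) (whiskerIdeal_isHomogeneous _)
  -- If two consecutive terms coincided, the layer would be zero and could not differ from its
  -- multiple by the irrelevant ideal.
  · refine lt_of_le_not_ge (whiskerSubmodule_mono (hss j hj).1) fun hle => hne j hj ?_
    have : Subsingleton (whiskerSubmodule G W n k (U (j + 1)) ⧸
        (whiskerSubmodule G W n k (U j)).submoduleOf (whiskerSubmodule G W n k (U (j + 1)))) := by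
      rw [Submodule.Quotient.subsingleton_iff, Submodule.submoduleOf_eq_top]
      exact hle
    exact Subsingleton.elim _ _
  · have hj' : j < D.card := (Nat.lt_succ_self j).trans hj
    have h₁ := (hpure j hj').supportDim_eq (hne j hj')
    have h₂ := (hpure (j + 1) hj).supportDim_eq (hne (j + 1) hj)
    refine h₁.trans_lt (lt_of_lt_of_eq ?_ h₂.symm)
    exact_mod_cast e.strictMono (show (⟨j, hj'⟩ : Fin D.card) < ⟨j + 1, hj⟩ from Nat.lt_succ_self j)

end SimpleGraph

theorem mainTheorem4 {V : Type*} [Fintype V] [DecidableEq V] (G : SimpleGraph V)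
    {r : ℕ} (W : Fin r → Set V) (hW : G.IsCliquePartition W)
    (n : Fin r → ℕ) (hn : ∀ i, 0 < n i) (k : Type*) [Field k] :
    (G.multiCliqueWhisker W n).IsVertexDecomposable ∧
      (G.multiCliqueWhisker W n).IsSequentiallyCohenMacaulay k :=
  ⟨SimpleGraph.isVertexDecomposable_multiCliqueWhisker hW hn,
    SimpleGraph.isSequentiallyCohenMacaulay_multiCliqueWhisker hW hn k⟩
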